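/- Let $E$ be a real Banach lattice and let $E^*$ be its norm dual, which is a Banach lattice under the order $f\le g \iff f(x)\le g(x)$ for all $x\ge 0$. Call a sequence $(f_n)$ in $E^*$ disjoint if $|f_n|\wedge|f_m|=0$ for all $n\ne m$. Suppose that $E$ has property (d): for every disjoint weak* null sequence $(f_n)$ in $E^*$, the sequence $(|f_n|)$ is also weak* null. A norm bounded set $A\subseteq E$ is called almost limited if every disjoint weak* null sequence $(f_n)$ in $E^*$ converges to zero uniformly on $A$. A bounded linear operator $T:E\to E$ is called almost limited if it maps the closed unit ball of $E$ to an almost limited set, and weak almost limited if it maps every relatively weakly compact subset of $E$ to an almost limited set. It is called positive if $Tx\ge 0$ whenever $x\ge 0$. Then the norm of $E^*$ is order continuous (that is, $\|f_\alpha\|\to 0$ for every net $f_\alpha\downarrow 0$ in $E^*$) if and only if every positive weak almost limited operator $T:E\to E$ is almost limited. -/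

import Mathlib

open Filter Topology

universe u

set_option linter.unusedSectionVars false

namespace BanachLattice

section Dual

variable {E : Type u} [NormedAddCommGroup E] [Lattice E] [HasSolidNorm E] [IsOrderedAddMonoid E]
  [NormedSpace ℝ E]

/-- The supremum of `f` over the order interval `[0, x]`. -/
noncomputable def posVal (f : StrongDual ℝ E) (x : E) : ℝ :=
  sSup (f '' Set.Icc 0 x)

theorem norm_mono {x y : E} (hx : 0 ≤ x) (hxy : x ≤ y) : ‖x‖ ≤ ‖y‖ := by
  apply HasSolidNorm.solid
  rwa [abs_of_nonneg hx, abs_of_nonneg (hx.trans hxy)]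

theorem posVal_bound (f : StrongDual ℝ E) (x : E) :
    ∀ r ∈ f '' Set.Icc 0 x, r ≤ ‖f‖ * ‖x‖ := by
  rintro _ ⟨y, hy, rfl⟩
  calc f y ≤ ‖f y‖ := le_abs_self _
    _ ≤ ‖f‖ * ‖y‖ := f.le_opNorm y
    _ ≤ ‖f‖ * ‖x‖ := by gcongr; exact norm_mono hy.1 hy.2

theorem le_posVal (f : StrongDual ℝ E) {x y : E} (h0 : 0 ≤ y) (hy : y ≤ x) :
    f y ≤ posVal f x :=
  le_csSup ⟨_, posVal_bound f x⟩ ⟨y, ⟨h0, hy⟩, rfl⟩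

theorem posVal_le (f : StrongDual ℝ E) {x : E} (hx : 0 ≤ x) {c : ℝ}
    (h : ∀ y, 0 ≤ y → y ≤ x → f y ≤ c) : posVal f x ≤ c := by
  refine csSup_le ⟨_, 0, ⟨le_rfl, hx⟩, rfl⟩ ?_
  rintro _ ⟨y, hy, rfl⟩
  exact h y hy.1 hy.2

theorem posVal_nonneg (f : StrongDual ℝ E) {x : E} (hx : 0 ≤ x) : 0 ≤ posVal f x := by
  simpa using le_posVal f (le_refl (0 : E)) hx

theorem posVal_add (f : StrongDual ℝ E) {x y : E} (hx : 0 ≤ x) (hy : 0 ≤ y) :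
    posVal f (x + y) = posVal f x + posVal f y := by
  apply le_antisymm
  · refine posVal_le f (add_nonneg hx hy) fun z hz hzxy => ?_
    have h1 : f (z ⊓ x) ≤ posVal f x := le_posVal f (le_inf hz hx) inf_le_right
    have h2 : f (z - z ⊓ x) ≤ posVal f y := by
      refine le_posVal f (sub_nonneg.2 inf_le_left) ?_
      rw [sub_le_iff_le_add, ← sub_le_iff_le_add']
      exact le_inf (sub_le_self _ hy) (sub_le_iff_le_add.2 hzxy)
    rw [map_sub] at h2
    linarith
  · rw [← le_sub_iff_add_le]
    refine posVal_le f hx fun a ha hax => ?_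
    rw [le_sub_comm]
    refine posVal_le f hy fun b hb hby => ?_
    rw [le_sub_iff_add_le', ← map_add]
    exact le_posVal f (add_nonneg ha hb) (add_le_add hax hby)

/-- The additive map `x ↦ posVal f x⁺ - posVal f x⁻`. -/
noncomputable def posHom (f : StrongDual ℝ E) : E →+ ℝ where
  toFun x := posVal f x⁺ - posVal f x⁻
  map_zero' := by simp
  map_add' x y := by
    have h : (x + y)⁺ + (x⁻ + y⁻) = (x⁺ + y⁺) + (x + y)⁻ := by
      have h1 := posPart_sub_negPart (x + y)
      have h2 := posPart_sub_negPart x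
      have h3 := posPart_sub_negPart y
      have h4 : (x + y)⁺ = (x⁺ - x⁻) + (y⁺ - y⁻) + (x + y)⁻ := by
        rw [h2, h3]; exact sub_eq_iff_eq_add.1 h1
      rw [h4]; abel
    have h' := congrArg (posVal f) h
    rw [posVal_add f (posPart_nonneg _) (add_nonneg (negPart_nonneg _) (negPart_nonneg _)),
      posVal_add f (negPart_nonneg _) (negPart_nonneg _),
      posVal_add f (add_nonneg (posPart_nonneg _) (posPart_nonneg _)) (negPart_nonneg _),
      posVal_add f (posPart_nonneg _) (posPart_nonneg _)] at h'
    linarith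

theorem posHom_of_nonneg (f : StrongDual ℝ E) {x : E} (hx : 0 ≤ x) :
    posHom f x = posVal f x := by
  have h0 : posVal f (0 : E) = 0 := by simp [posVal]
  change posVal f x⁺ - posVal f x⁻ = _
  rw [posPart_of_nonneg hx, negPart_of_nonneg hx, h0, sub_zero]

theorem posHom_bound (f : StrongDual ℝ E) (x : E) : ‖posHom f x‖ ≤ ‖f‖ * ‖x‖ := by
  have key : ∀ z : E, 0 ≤ z → ‖z‖ ≤ ‖x‖ → posVal f z ≤ ‖f‖ * ‖x‖ := fun z hz hzx =>
    posVal_le f hz fun y h0 hy => (posVal_bound f z _ ⟨y, ⟨h0, hy⟩, rfl⟩).trans (by gcongr)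
  have hp : ‖x⁺‖ ≤ ‖x‖ := by
    rw [← norm_abs_eq_norm x]
    refine norm_mono (posPart_nonneg x) ?_
    exact sup_le (le_abs_self x) (abs_nonneg x)
  have hn : ‖x⁻‖ ≤ ‖x‖ := by
    rw [← norm_abs_eq_norm x]
    refine norm_mono (negPart_nonneg x) ?_
    exact sup_le (neg_le_abs x) (abs_nonneg x)
  have h1 := key _ (posPart_nonneg x) hp
  have h2 := key _ (negPart_nonneg x) hn
  have h3 := posVal_nonneg f (posPart_nonneg x)
  have h4 := posVal_nonneg f (negPart_nonneg x)
  change |posVal f x⁺ - posVal f x⁻| ≤ _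
  rw [abs_le]
  constructor <;> linarith

/-- The positive part `f⁺` of `f` in the dual: `f⁺ x = sup {f y : 0 ≤ y ≤ x}` for `0 ≤ x`. -/
noncomputable def dualPos (f : StrongDual ℝ E) : StrongDual ℝ E :=
  (posHom f).toRealLinearMap (AddMonoidHomClass.continuous_of_bound (posHom f) ‖f‖ (posHom_bound f))

theorem dualPos_of_nonneg (f : StrongDual ℝ E) {x : E} (hx : 0 ≤ x) :
    dualPos f x = sSup (f '' Set.Icc 0 x) :=
  posHom_of_nonneg f hx

/-- The order of the dual: `f ≤ g` if and only if `f x ≤ g x` for all `x ≥ 0`. -/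
instance instPartialOrderDual : PartialOrder (StrongDual ℝ E) where
  le f g := ∀ x : E, 0 ≤ x → f x ≤ g x
  le_refl _ _ _ := le_rfl
  le_trans _ _ _ h1 h2 x hx := (h1 x hx).trans (h2 x hx)
  le_antisymm f g h1 h2 := by
    ext x
    rw [← posPart_sub_negPart x, map_sub, map_sub,
      (h1 _ (posPart_nonneg x)).antisymm (h2 _ (posPart_nonneg x)),
      (h1 _ (negPart_nonneg x)).antisymm (h2 _ (negPart_nonneg x))]

theorem dual_le_iff {f g : StrongDual ℝ E} : f ≤ g ↔ ∀ x : E, 0 ≤ x → f x ≤ g x :=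
  Iff.rfl

instance instIsOrderedAddMonoidDual : IsOrderedAddMonoid (StrongDual ℝ E) where
  add_le_add_left f g h k x hx := by
    have := h x hx
    simpa using this

theorem le_dualPos (f : StrongDual ℝ E) : f ≤ dualPos f := fun x hx => by
  rw [dualPos_of_nonneg f hx]
  exact le_posVal f hx le_rfl

theorem dualPos_nonneg (f : StrongDual ℝ E) : 0 ≤ dualPos f := fun x hx => by
  rw [dualPos_of_nonneg f hx]
  exact posVal_nonneg f hx

theorem dualPos_le {f g : StrongDual ℝ E} (h0 : 0 ≤ g) (h : f ≤ g) : dualPos f ≤ g :=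
  fun x hx => by
    rw [dualPos_of_nonneg f hx]
    refine posVal_le f hx fun y hy hyx => (h y hy).trans ?_
    have := h0 (x - y) (sub_nonneg.2 hyx)
    simpa using this

/-- The lattice structure of the dual `E*` of a normed lattice `E`, with `f ⊔ g = f + (g - f)⁺`. -/
noncomputable instance instLatticeDual : Lattice (StrongDual ℝ E) where
  sup f g := f + dualPos (g - f)
  le_sup_left f g := le_add_of_nonneg_right (dualPos_nonneg _)
  le_sup_right f g := sub_le_iff_le_add'.1 (le_dualPos _)
  sup_le f g h h1 h2 := by
    rw [← le_sub_iff_add_le']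
    exact dualPos_le (sub_nonneg.2 h1) (sub_le_sub_right h2 f)
  inf f g := f - dualPos (f - g)
  inf_le_left f g := sub_le_self _ (dualPos_nonneg _)
  inf_le_right f g := sub_le_comm.1 (le_dualPos _)
  le_inf f g h h1 h2 := by
    rw [le_sub_comm]
    exact dualPos_le (sub_nonneg.2 h1) (sub_le_sub_left h2 g)

end Dual

/-- A normed lattice has order continuous norm if `x_i ↓ 0` implies `‖x_i‖ → 0` for all nets. -/
def HasOrderContinuousNorm (X : Type u) [NormedAddCommGroup X] [Lattice X] : Prop :=
  ∀ (ι : Type u) [Preorder ι] [IsDirectedOrder ι] [Nonempty ι] (x : ι → X),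
    Antitone x → IsGLB (Set.range x) 0 → Tendsto (fun i => ‖x i‖) atTop (𝓝 0)

/-- A subset of a normed space is relatively weakly compact if its weak closure is weakly
compact. -/
def IsRelWeaklyCompact {X : Type u} [NormedAddCommGroup X] [NormedSpace ℝ X] (W : Set X) : Prop :=
  IsCompact (closure (toWeakSpace ℝ X '' W))

/-- A weak* null sequence of functionals. -/
def IsWeakStarNull {X : Type u} [NormedAddCommGroup X] [NormedSpace ℝ X]
    (f : ℕ → StrongDual ℝ X) : Prop :=
  Tendsto (fun n => StrongDual.toWeakDual (f n)) atTop (𝓝 0)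

section Operators

variable {E : Type u} [NormedAddCommGroup E] [Lattice E] [HasSolidNorm E] [IsOrderedAddMonoid E]
  [NormedSpace ℝ E]

/-- A disjoint sequence in the dual: `|f_n| ⊓ |f_m| = 0` whenever `n ≠ m`. -/
def IsDisjointSeq (f : ℕ → StrongDual ℝ E) : Prop :=
  Pairwise fun n m => |f n| ⊓ |f m| = 0

variable (E) in
/-- Property (d): for every disjoint weak* null sequence `(f_n)` in the dual, the sequence
`(|f_n|)` is weak* null. -/
def PropertyD : Prop :=
  ∀ f : ℕ → StrongDual ℝ E, IsDisjointSeq f → IsWeakStarNull f → IsWeakStarNull fun n => |f n|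

/-- A norm bounded set on which every disjoint weak* null sequence in the dual converges
uniformly to zero. -/
def IsAlmostLimitedSet (A : Set E) : Prop :=
  Bornology.IsBounded A ∧
    ∀ f : ℕ → StrongDual ℝ E, IsDisjointSeq f → IsWeakStarNull f →
      TendstoUniformlyOn (fun n x => f n x) (fun _ => 0) atTop A

variable {X : Type u} [NormedAddCommGroup X] [NormedSpace ℝ X]

/-- An operator is almost limited if it maps the closed unit ball to an almost limited set. -/
def IsAlmostLimited (T : X →L[ℝ] E) : Prop :=
  IsAlmostLimitedSet (T '' Metric.closedBall 0 1)

/-- An operator is weak almost limited if it maps relatively weakly compact sets to almost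
limited sets. -/
def IsWeakAlmostLimited (T : X →L[ℝ] E) : Prop :=
  ∀ W : Set X, IsRelWeaklyCompact W → IsAlmostLimitedSet (T '' W)

end Operators

/-- A positive operator between ordered spaces. -/
def IsPositiveOperator {E F : Type u} [NormedAddCommGroup E] [Lattice E] [NormedSpace ℝ E]
    [NormedAddCommGroup F] [Lattice F] [NormedSpace ℝ F] (T : E →L[ℝ] F) : Prop :=
  ∀ x : E, 0 ≤ x → 0 ≤ T x

end BanachLattice

namespace BanachLattice

/-! ### Lattice-ordered groups: disjointness and components in principal bands. -/

section LatticeGroup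

variable {G : Type*} [AddCommGroup G] [Lattice G] [IsOrderedAddMonoid G]

/-! Suppose the dual norm is order continuous, and let `(f_n)` be disjoint and weak* null. By (d),
the functionals `g_n = |f_n| ∘ T` are positive and pointwise null, and `|f_n (T x)| ≤ g_n |x|`, so
it suffices that `‖g_n‖ → 0`. A disjointification argument (`tendsto_norm_zero_of_disjoint`) reduces
this to uniform smallness on each disjoint positive sequence `(y_k)` in the unit ball. Such a
sequence is weakly null (`tendsto_apply_of_disjoint`): the components of `|h|` along the `y_k` have
sums at most `|h|`, so their norms tend to zero. Hence `T` sends `{y_k}` to an almost limited set,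
on which `|f_n|` is uniformly null.

Conversely, if order continuity fails, cutting a bad decreasing net into components of one
functional `g` gives disjoint `0 ≤ f_n ≤ g` with `‖f_n‖ ≥ ε`
(`exists_disjoint_of_not_hasOrderContinuousNorm`). Take positive `x_n` in the unit ball with
`f_n(x_n) ≥ ‖f_n‖ / 2` and put `T z = ∑ f_n(z) x_n`. This positive operator factors through `ℓ¹`,
where weakly compact sets have uniformly small tails by the Schur property (`exists_uniform_tail`),
so `T` is weak almost limited. It is not almost limited: `f_n` is disjoint and weak* null, while
`f_n(T x_n) ≥ f_n(x_n)² ≥ ε²/4`. -/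

theorem inf_add_le_inf_add_inf {a b c : G} (ha : 0 ≤ a) (hb : 0 ≤ b) (hc : 0 ≤ c) :
    a ⊓ (b + c) ≤ a ⊓ b + a ⊓ c := by
  rw [add_inf]
  refine le_inf (inf_le_left.trans (le_add_of_nonneg_left (le_inf ha hb))) ?_
  rw [inf_add]
  exact inf_le_inf_right _ (le_add_of_nonneg_right hc)

theorem inf_nsmul_le_nsmul_inf {a b : G} (ha : 0 ≤ a) (hb : 0 ≤ b) (n : ℕ) :
    a ⊓ n • b ≤ n • (a ⊓ b) := by
  induction n with
  | zero => simp
  | succ n ih =>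
    rw [succ_nsmul, succ_nsmul]
    exact (inf_add_le_inf_add_inf ha (nsmul_nonneg hb n) hb).trans (add_le_add_left ih _)

theorem inf_sum_eq_zero {a : G} {b : ℕ → G} (ha : 0 ≤ a) (hb : ∀ k, 0 ≤ b k) (n : ℕ)
    (h : ∀ k < n, a ⊓ b k = 0) : a ⊓ ∑ k ∈ Finset.range n, b k = 0 := by
  induction n with
  | zero => simpa using ha
  | succ n ih =>
    refine le_antisymm ?_ (le_inf ha (Finset.sum_nonneg fun k _ => hb k))
    rw [Finset.sum_range_succ]
    refine (inf_add_le_inf_add_inf ha (Finset.sum_nonneg fun k _ => hb k) (hb n)).trans ?_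
    rw [ih fun k hk => h k (by omega), h n (by omega), add_zero]

/-- The sum of disjoint positive elements is their supremum. -/
theorem sum_le_of_disjoint {b : ℕ → G} {x : G} (hx : 0 ≤ x) (hb : ∀ k, 0 ≤ b k)
    (hd : Pairwise fun i j => b i ⊓ b j = 0) (hbx : ∀ k, b k ≤ x) (n : ℕ) :
    ∑ k ∈ Finset.range n, b k ≤ x := by
  induction n with
  | zero => simpa using hx
  | succ n ih =>
    rw [Finset.sum_range_succ, add_comm, ← inf_add_sup,
      inf_sum_eq_zero (hb n) hb n fun k hk => hd (by omega), zero_add]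
    exact sup_le (hbx n) ih

theorem inf_eq_zero_of_le {a b c d : G} (ha : 0 ≤ a) (hb : 0 ≤ b) (hac : a ≤ c) (hbd : b ≤ d)
    (h : c ⊓ d = 0) : a ⊓ b = 0 :=
  le_antisymm ((inf_le_inf hac hbd).trans h.le) (le_inf ha hb)

/-- Since `F - a ≤ F + a⁻` and `a⁺` is disjoint from `a⁻`, only `F` can meet multiples of `a⁺`. With
`a = N f - g` and `F = N f` it bounds a band component of `g` by `N f`. -/
theorem nsmul_posPart_inf_sub_le {a F : G} (hF : 0 ≤ F) (n : ℕ) :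
    n • a⁺ ⊓ (F - a) ≤ F := by
  have h1 : F - a ≤ F + a⁻ := by
    rw [sub_eq_add_neg]; gcongr; exact neg_le_negPart a
  have h2 : n • a⁺ ⊓ a⁻ ≤ 0 := by
    rw [inf_comm]
    refine (inf_nsmul_le_nsmul_inf (negPart_nonneg a) (posPart_nonneg a) n).trans ?_
    rw [inf_comm, posPart_inf_negPart_eq_zero, nsmul_zero]
  calc n • a⁺ ⊓ (F - a) ≤ n • a⁺ ⊓ (F + a⁻) := inf_le_inf_left _ h1
    _ ≤ n • a⁺ ⊓ F + n • a⁺ ⊓ a⁻ :=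
      inf_add_le_inf_add_inf (nsmul_nonneg (posPart_nonneg a) n) hF (negPart_nonneg a)
    _ ≤ F + 0 := add_le_add inf_le_right h2
    _ = F := add_zero F

/-- `R` is the component of `g` in the band generated by `h`. -/
def IsBandComponent (g h R : G) : Prop :=
  IsLUB (Set.range fun n : ℕ => n • h ⊓ g) R

namespace IsBandComponent

variable {g h h' R R' : G}

theorem inf_le (H : IsBandComponent g h R) (n : ℕ) : n • h ⊓ g ≤ R :=
  H.1 ⟨n, rfl⟩

theorem le_iff (H : IsBandComponent g h R) {c : G} : R ≤ c ↔ ∀ n : ℕ, n • h ⊓ g ≤ c := by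
  rw [isLUB_le_iff H]
  simp [upperBounds]

theorem le (H : IsBandComponent g h R) : R ≤ g :=
  H.le_iff.2 fun _ => inf_le_right

theorem nonneg (H : IsBandComponent g h R) (hg : 0 ≤ g) : 0 ≤ R := by
  simpa [inf_eq_left.2 hg] using H.inf_le 0

theorem mono (H : IsBandComponent g h R) (H' : IsBandComponent g h' R') (hh : h ≤ h') :
    R ≤ R' :=
  H.le_iff.2 fun n => (inf_le_inf_right _ (nsmul_le_nsmul_right hh n)).trans (H'.inf_le n)

/-- Adding `(g - R) ⊓ h` to `n h ⊓ g` stays below `(n + 1) h ⊓ g ≤ R`; take the supremum over `n`.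
-/
theorem sub_inf_le (H : IsBandComponent g h R) : (g - R) ⊓ h ≤ 0 := by
  rw [← add_le_iff_nonpos_right R, ← le_sub_iff_add_le]
  refine H.le_iff.2 fun n => ?_
  rw [le_sub_iff_add_le]
  refine le_trans (le_inf ?_ ?_) (H.inf_le (n + 1))
  · rw [succ_nsmul]
    exact add_le_add inf_le_left inf_le_right
  · calc n • h ⊓ g + (g - R) ⊓ h ≤ R + (g - R) := add_le_add (H.inf_le n) inf_le_left
      _ = g := add_sub_cancel R g

theorem inf_sub_eq_zero (H : IsBandComponent g h R) (hg : 0 ≤ g) (hh : 0 ≤ h) :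
    R ⊓ (g - R) = 0 := by
  have hgR : 0 ≤ g - R := sub_nonneg.2 H.le
  refine le_antisymm ?_ (le_inf (H.nonneg hg) hgR)
  -- By `a ⊓ b + a ⊔ b = a + b`, this inequality says exactly that `R ⊓ (g - R) ≤ 0`, in a form that
  -- can be tested on each `n h ⊓ g`.
  have key : R ≤ R ⊔ (g - R) - (g - R) := H.le_iff.2 fun n => by
    rw [le_sub_iff_add_le, ← inf_add_sup]
    have h1 : n • h ⊓ g ⊓ (g - R) ≤ 0 := by
      calc n • h ⊓ g ⊓ (g - R) ≤ (g - R) ⊓ n • h := by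
            rw [inf_comm]; exact inf_le_inf_left _ inf_le_left
        _ ≤ n • ((g - R) ⊓ h) := inf_nsmul_le_nsmul_inf hgR hh n
        _ ≤ 0 := nsmul_nonpos (H.sub_inf_le) n
    calc _ ≤ 0 + R ⊔ (g - R) := add_le_add h1 (sup_le_sup_right (H.inf_le n) _)
      _ = _ := zero_add _
  rw [le_sub_iff_add_le, ← inf_add_sup] at key
  simpa using key

/-- The component of `g` in the band generated by `(N f - g)⁺` is at most `N f`. -/
theorem le_nsmul {f : G} {N : ℕ} (H : IsBandComponent g (N • f - g)⁺ R) (hf : 0 ≤ f) :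
    R ≤ N • f :=
  H.le_iff.2 fun n => by
    simpa using nsmul_posPart_inf_sub_le (a := N • f - g) (nsmul_nonneg hf N) n

/-- Together with `(N f - g)⁺ ≤ N R`, this shows that `R` keeps the norm of `f` up to a loss of `‖g‖
/ N`. -/
theorem nsmul_le {f : G} {N : ℕ} (H : IsBandComponent g (N • f - g)⁺ R) (hf : 0 ≤ f)
    (hfg : f ≤ g) : N • f ≤ g + N • R := by
  have hg := hf.trans hfg
  have h1 : (N • f - g)⁺ ≤ N • g := by
    rw [posPart_def]
    exact sup_le ((sub_le_self _ hg).trans (nsmul_le_nsmul_right hfg N)) (nsmul_nonneg hg N)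
  have h2 : (N • f - g)⁺ ≤ N • R := by
    calc (N • f - g)⁺ = (N • f - g)⁺ ⊓ N • g := (inf_eq_left.2 h1).symm
      _ ≤ N • ((N • f - g)⁺ ⊓ g) := inf_nsmul_le_nsmul_inf (posPart_nonneg _) hg N
      _ ≤ N • R := nsmul_le_nsmul_right (by simpa using H.inf_le 1) N
  rw [← sub_le_iff_le_add']
  exact (le_posPart _).trans h2

/-- Differences of a decreasing sequence of components are disjoint. -/
theorem pairwise_inf_sub_eq_zero {h R : ℕ → G} (H : ∀ k, IsBandComponent g (h k) (R k))
    (hg : 0 ≤ g) (hh : ∀ k, 0 ≤ h k) (hR : Antitone R) :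
    Pairwise fun j k => (R j - R (j + 1)) ⊓ (R k - R (k + 1)) = 0 := by
  -- For `j < k` the later difference lies below `R (j + 1)` and the earlier one below the
  -- complementary component `g - R (j + 1)`.
  have key : ∀ j k, j < k → (R j - R (j + 1)) ⊓ (R k - R (k + 1)) = 0 := fun j k hjk => by
    rw [inf_comm]
    refine inf_eq_zero_of_le (sub_nonneg.2 (hR k.le_succ)) (sub_nonneg.2 (hR j.le_succ))
      ?_ ?_ ((H (j + 1)).inf_sub_eq_zero hg (hh _))
    · exact (sub_le_self _ ((H _).nonneg hg)).trans (hR hjk)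
    · exact sub_le_sub_right (H j).le _
  intro j k hjk
  rcases hjk.lt_or_gt with h1 | h1
  · exact key j k h1
  · simpa only [inf_comm] using key k j h1

end IsBandComponent

end LatticeGroup

theorem exists_seq_rel_succ {α : Type*} {r : α → α → Prop} (h : ∀ a, ∃ b, r a b) (a : α) :
    ∃ s : ℕ → α, s 0 = a ∧ ∀ k, r (s k) (s (k + 1)) := by
  choose F hF using h
  exact ⟨fun k => F^[k] a, rfl, fun k => by
    simpa only [Function.iterate_succ_apply'] using hF _⟩

/-! ### The dual: norms of positive functionals and monotone limits. -/

section Dual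

variable {E : Type u} [NormedAddCommGroup E] [Lattice E] [HasSolidNorm E] [IsOrderedAddMonoid E]
  [NormedSpace ℝ E]

theorem isWeakStarNull_iff {X : Type u} [NormedAddCommGroup X] [NormedSpace ℝ X]
    {f : ℕ → StrongDual ℝ X} :
    IsWeakStarNull f ↔ ∀ x, Tendsto (fun n => f n x) atTop (𝓝 0) :=
  tendsto_iff_forall_eval_tendsto_topDualPairing

theorem dual_monotone {f : StrongDual ℝ E} (hf : 0 ≤ f) {x y : E} (h : x ≤ y) : f x ≤ f y := by
  simpa using hf (y - x) (sub_nonneg.2 h)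

theorem abs_apply_le_apply_abs {f : StrongDual ℝ E} (hf : 0 ≤ f) (x : E) : |f x| ≤ f |x| :=
  abs_le.2 ⟨by simpa using dual_monotone hf (neg_le.1 (neg_le_abs x)), dual_monotone hf (le_abs_self x)⟩

theorem abs_apply_le_abs (f : StrongDual ℝ E) (x : E) : |f x| ≤ (|f| : StrongDual ℝ E) |x| := by
  have h1 : ∀ y : E, 0 ≤ y → |f y| ≤ (|f| : StrongDual ℝ E) y := fun y hy =>
    abs_le.2 ⟨by have := neg_le_abs f y hy; rw [neg_apply] at this; linarith,
      le_abs_self f y hy⟩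
  have h2 := congrArg f (posPart_sub_negPart x)
  have h3 := congrArg (|f| : StrongDual ℝ E) (posPart_add_negPart x)
  rw [map_sub] at h2
  rw [map_add] at h3
  rw [← h2, ← h3]
  exact (abs_sub _ _).trans (add_le_add (h1 _ (posPart_nonneg x)) (h1 _ (negPart_nonneg x)))

theorem dual_norm_le {f : StrongDual ℝ E} (hf : 0 ≤ f) {C : ℝ} (hC : 0 ≤ C)
    (h : ∀ x, 0 ≤ x → f x ≤ C * ‖x‖) : ‖f‖ ≤ C :=
  f.opNorm_le_bound hC fun x => (abs_apply_le_apply_abs hf x).trans <| by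
    simpa only [norm_abs_eq_norm] using h |x| (abs_nonneg x)

theorem dual_norm_mono {f g : StrongDual ℝ E} (hf : 0 ≤ f) (h : f ≤ g) : ‖f‖ ≤ ‖g‖ :=
  dual_norm_le hf (norm_nonneg g) fun x hx =>
    (h x hx).trans ((le_abs_self _).trans (g.le_opNorm x))

theorem exists_nonneg_lt_apply {f : StrongDual ℝ E} (hf : 0 ≤ f) {r : ℝ} (hr : r < ‖f‖) :
    ∃ x, 0 ≤ x ∧ ‖x‖ ≤ 1 ∧ r < f x := by
  obtain ⟨x, hx, h⟩ := f.exists_lt_apply_of_lt_opNorm hr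
  exact ⟨|x|, abs_nonneg x, by rw [norm_abs_eq_norm]; exact hx.le, h.trans_le (abs_apply_le_apply_abs hf x)⟩

theorem exists_nonneg_half_norm_le {f : StrongDual ℝ E} (hf : 0 ≤ f) :
    ∃ x, 0 ≤ x ∧ ‖x‖ ≤ 1 ∧ ‖f‖ / 2 ≤ f x := by
  rcases (norm_nonneg f).eq_or_lt with h | h
  · exact ⟨0, le_rfl, by simp, by simp [← h]⟩
  · obtain ⟨x, h0, h1, h2⟩ := exists_nonneg_lt_apply hf (half_lt_self h)
    exact ⟨x, h0, h1, h2.le⟩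

/-- A bounded positive additive function on the positive cone extends to a functional. -/
theorem exists_dual_of_additive (p : E → ℝ) (C : ℝ)
    (hadd : ∀ x y, 0 ≤ x → 0 ≤ y → p (x + y) = p x + p y) (h0 : ∀ x, 0 ≤ x → 0 ≤ p x)
    (hC : ∀ x, 0 ≤ x → p x ≤ C * ‖x‖) : ∃ ψ : StrongDual ℝ E, ∀ x, 0 ≤ x → ψ x = p x := by
  have hp0 : p 0 = 0 := by simpa using hadd 0 0 le_rfl le_rfl
  let P : E →+ ℝ :=
    { toFun := fun x => p x⁺ - p x⁻
      map_zero' := by simp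
      map_add' := fun x y => by
        have h : (x + y)⁺ + (x⁻ + y⁻) = (x⁺ + y⁺) + (x + y)⁻ := by
          have h1 := posPart_sub_negPart (x + y)
          have h2 := posPart_sub_negPart x
          have h3 := posPart_sub_negPart y
          have h4 : (x + y)⁺ = (x⁺ - x⁻) + (y⁺ - y⁻) + (x + y)⁻ := by
            rw [h2, h3]; exact sub_eq_iff_eq_add.1 h1
          rw [h4]; abel
        have h' := congrArg p h
        rw [hadd _ _ (posPart_nonneg _) (add_nonneg (negPart_nonneg _) (negPart_nonneg _)),
          hadd _ _ (negPart_nonneg _) (negPart_nonneg _),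
          hadd _ _ (add_nonneg (posPart_nonneg _) (posPart_nonneg _)) (negPart_nonneg _),
          hadd _ _ (posPart_nonneg _) (posPart_nonneg _)] at h'
        linarith }
  have hP : ∀ x, ‖P x‖ ≤ C * ‖x‖ := fun x => by
    have h1 : p x⁺ + p x⁻ = p |x| := by
      rw [← hadd _ _ (posPart_nonneg _) (negPart_nonneg _), posPart_add_negPart]
    have h2 := hC |x| (abs_nonneg x)
    rw [norm_abs_eq_norm] at h2
    have h3 := h0 _ (posPart_nonneg x)
    have h4 := h0 _ (negPart_nonneg x)
    change |p x⁺ - p x⁻| ≤ _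
    rw [abs_le]
    constructor <;> linarith
  refine ⟨P.toRealLinearMap (AddMonoidHomClass.continuous_of_bound P C hP), fun x hx => ?_⟩
  change p x⁺ - p x⁻ = _
  rw [posPart_of_nonneg hx, negPart_of_nonneg hx, hp0, sub_zero]

/-- Additivity on the positive cone passes to pointwise limits, so a bounded positive limit extends
to a functional. -/
theorem exists_dual_of_tendsto {ι : Type*} {l : Filter ι} [NeBot l] {φ : ι → StrongDual ℝ E}
    {p : E → ℝ} {C : ℝ} (h : ∀ x, 0 ≤ x → Tendsto (fun i => φ i x) l (𝓝 (p x)))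
    (h0 : ∀ x, 0 ≤ x → 0 ≤ p x) (hC : ∀ x, 0 ≤ x → p x ≤ C * ‖x‖) :
    ∃ ψ : StrongDual ℝ E, ∀ x, 0 ≤ x → Tendsto (fun i => φ i x) l (𝓝 (ψ x)) := by
  obtain ⟨ψ, hψ⟩ := exists_dual_of_additive p C (fun x y hx hy => by
    refine tendsto_nhds_unique (h _ (add_nonneg hx hy)) ?_
    simpa using (h x hx).add (h y hy)) h0 hC
  exact ⟨ψ, fun x hx => by rw [hψ x hx]; exact h x hx⟩

theorem exists_dual_tendsto_of_monotone {ι : Type*} [Preorder ι] [IsDirectedOrder ι] [Nonempty ι]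
    {φ : ι → StrongDual ℝ E} {g : StrongDual ℝ E} (hφ : Monotone φ) (h0 : ∀ i, 0 ≤ φ i)
    (hg : ∀ i, φ i ≤ g) :
    ∃ ψ : StrongDual ℝ E, ∀ x, 0 ≤ x → Tendsto (fun i => φ i x) atTop (𝓝 (ψ x)) := by
  have hb : ∀ x : E, 0 ≤ x → BddAbove (Set.range fun i => φ i x) := fun x hx =>
    ⟨g x, by rintro _ ⟨i, rfl⟩; exact hg i x hx⟩
  refine exists_dual_of_tendsto (p := fun x => ⨆ i, φ i x) (C := ‖g‖)
    (fun x hx => tendsto_atTop_ciSup (fun i j hij => hφ hij x hx) (hb x hx))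
    (fun x hx => Real.iSup_nonneg fun i => h0 i x hx) fun x hx =>
      ciSup_le fun i => (hg i x hx).trans ((le_abs_self _).trans (g.le_opNorm x))

theorem isLUB_of_tendsto {ι : Type*} [Preorder ι] [IsDirectedOrder ι] [Nonempty ι]
    {φ : ι → StrongDual ℝ E} {ψ : StrongDual ℝ E} (hφ : Monotone φ)
    (h : ∀ x, 0 ≤ x → Tendsto (fun i => φ i x) atTop (𝓝 (ψ x))) : IsLUB (Set.range φ) ψ := by
  refine ⟨?_, fun c hc x hx => le_of_tendsto' (h x hx) fun i => hc ⟨i, rfl⟩ x hx⟩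
  rintro _ ⟨i, rfl⟩ x hx
  exact Monotone.ge_of_tendsto (f := fun i => φ i x) (fun i j hij => hφ hij x hx) (h x hx) i

theorem isGLB_zero_of_tendsto {ι : Type*} [Preorder ι] [IsDirectedOrder ι] [Nonempty ι]
    {φ : ι → StrongDual ℝ E} (hφ : Antitone φ)
    (h : ∀ x, 0 ≤ x → Tendsto (fun i => φ i x) atTop (𝓝 0)) : IsGLB (Set.range φ) 0 := by
  refine ⟨?_, fun c hc x hx => ge_of_tendsto' (h x hx) fun i => hc ⟨i, rfl⟩ x hx⟩
  rintro _ ⟨i, rfl⟩ x hx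
  exact Antitone.le_of_tendsto (f := fun i => φ i x) (fun i j hij => hφ hij x hx) (h x hx) i

/-- The pointwise infimum of a decreasing net is again a functional and a lower bound, so it cannot
exceed the greatest lower bound. -/
theorem tendsto_zero_of_isGLB {ι : Type*} [Preorder ι] [IsDirectedOrder ι] [Nonempty ι]
    {φ : ι → StrongDual ℝ E} (hφ : Antitone φ) (h : IsGLB (Set.range φ) 0) {x : E} (hx : 0 ≤ x) :
    Tendsto (fun i => φ i x) atTop (𝓝 0) := by
  have h0 : ∀ i, 0 ≤ φ i := fun i => h.1 ⟨i, rfl⟩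
  have hb : ∀ x : E, 0 ≤ x → BddBelow (Set.range fun i => φ i x) := fun x hx =>
    ⟨0, by rintro _ ⟨i, rfl⟩; exact h0 i x hx⟩
  let i₀ : ι := Classical.arbitrary ι
  obtain ⟨ψ, hψ⟩ := exists_dual_of_tendsto (φ := φ) (p := fun x => ⨅ i, φ i x) (C := ‖φ i₀‖)
    (fun x hx => tendsto_atTop_ciInf (fun i j hij => hφ hij x hx) (hb x hx))
    (fun x hx => Real.iInf_nonneg fun i => h0 i x hx) fun x hx =>
      (ciInf_le (hb x hx) i₀).trans ((le_abs_self _).trans ((φ i₀).le_opNorm x))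
  have h1 : ψ ≤ 0 := h.2 (by
    rintro _ ⟨i, rfl⟩ x hx
    exact Antitone.le_of_tendsto (f := fun i => φ i x) (fun i j hij => hφ hij x hx) (hψ x hx) i)
  have h2 : 0 ≤ ψ := fun x hx => ge_of_tendsto' (hψ x hx) fun i => h0 i x hx
  have h3 := hψ x hx
  rwa [le_antisymm h1 h2] at h3

theorem exists_isBandComponent {g h : StrongDual ℝ E} (hg : 0 ≤ g) (hh : 0 ≤ h) :
    ∃ R, IsBandComponent g h R := by
  have hm : Monotone fun n : ℕ => n • h ⊓ g := fun m n hmn =>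
    inf_le_inf_right _ (nsmul_le_nsmul_left hh hmn)
  obtain ⟨R, hR⟩ := exists_dual_tendsto_of_monotone hm
    (fun n => le_inf (nsmul_nonneg hh n) hg) fun n => inf_le_right
  exact ⟨R, isLUB_of_tendsto hm hR⟩

end Dual

end BanachLattice

namespace BanachLattice

/-! ### The Schur property of `ℓ¹`, by Baire category on the space of signs. -/

section Schur

/-- The sign `1` or `-1` attached to a Boolean. -/
def boolSign (b : Bool) : ℝ := if b then 1 else -1

theorem abs_boolSign (b : Bool) : |boolSign b| = 1 := by
  cases b <;> simp [boolSign]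

/-- A sequence of absolutely convergent series whose signed sums all tend to zero is null in
`ℓ¹`. -/
theorem tendsto_tsum_abs_of_signed {y : ℕ → ℕ → ℝ} (hy : ∀ j, Summable fun n => |y j n|)
    (hc : ∀ n, Tendsto (fun j => y j n) atTop (𝓝 0))
    (hs : ∀ σ : ℕ → Bool, Tendsto (fun j => ∑' n, boolSign (σ n) * y j n) atTop (𝓝 0)) :
    Tendsto (fun j => ∑' n, |y j n|) atTop (𝓝 0) := by
  have habs : ∀ (σ : ℕ → Bool) j n, |boolSign (σ n) * y j n| = |y j n| := fun σ j n => by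
    rw [abs_mul, abs_boolSign, one_mul]
  have hcont : ∀ j, Continuous fun σ : ℕ → Bool => ∑' n, boolSign (σ n) * y j n := fun j =>
    continuous_tsum (fun n => ((continuous_of_discreteTopology (f := boolSign)).comp
      (continuous_apply n)).mul continuous_const) (hy j) fun n σ => (habs σ j n).le
  have hsum : ∀ (σ : ℕ → Bool) j, Summable fun n => boolSign (σ n) * y j n := fun σ j =>
    ((hy j).congr fun n => (habs σ j n).symm).of_abs
  rw [Metric.tendsto_atTop]
  intro ε hε
  -- These closed sets cover the compact space of sign sequences, so one of them contains a basic
  -- open set, which constrains only the finitely many coordinates in `I`.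
  let F : ℕ → Set (ℕ → Bool) := fun m =>
    {σ | ∀ j, m ≤ j → |∑' n, boolSign (σ n) * y j n| ≤ ε / 2}
  have hF : ∀ m, IsClosed (F m) := fun m => by
    have : F m = ⋂ j, ⋂ _ : m ≤ j, {σ | |∑' n, boolSign (σ n) * y j n| ≤ ε / 2} := by
      ext σ; simp [F]
    rw [this]
    exact isClosed_iInter fun j => isClosed_iInter fun _ =>
      isClosed_le (hcont j).abs continuous_const
  have hU : ⋃ m, F m = Set.univ := by
    refine Set.eq_univ_of_forall fun σ => Set.mem_iUnion.2 ?_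
    obtain ⟨m, hm⟩ := Metric.tendsto_atTop.1 (hs σ) (ε / 2) (half_pos hε)
    exact ⟨m, fun j hj => by simpa [Real.dist_eq] using (hm j hj).le⟩
  obtain ⟨m, σ₀, hσ₀⟩ := nonempty_interior_of_iUnion_of_closed hF hU
  obtain ⟨I, u, hu, hI⟩ := isOpen_pi_iff.1 isOpen_interior σ₀ hσ₀
  have hlim : Tendsto (fun j => ∑ n ∈ I, 2 * |y j n|) atTop (𝓝 0) := by
    simpa using tendsto_finsetSum I fun n _ => (hc n).abs.const_mul 2
  obtain ⟨m', hm'⟩ := Metric.tendsto_atTop.1 hlim (ε / 2) (half_pos hε)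
  refine ⟨max m m', fun j hj => ?_⟩
  have h1 := hm' j ((le_max_right _ _).trans hj)
  rw [Real.dist_eq, sub_zero] at h1
  replace h1 := (le_abs_self _).trans_lt h1
  -- On `I` the signs stay in the basic open set; off `I` they are those of `y j`, so the signed sum
  -- differs from the `ℓ¹` norm only through the coordinates in `I`.
  let σ : ℕ → Bool := fun n => if n ∈ I then σ₀ n else decide (0 ≤ y j n)
  have hσ : σ ∈ F m := interior_subset <| hI fun n hn => by
    have hn' : n ∈ I := hn
    simp only [σ, if_pos hn']
    exact (hu n hn').2
  have h2 := (le_abs_self _).trans (hσ j ((le_max_left _ _).trans hj))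
  have hoff : ∀ n ∉ I, |y j n| - boolSign (σ n) * y j n = 0 := fun n hn => by
    simp only [σ, if_neg hn, boolSign]
    by_cases h : 0 ≤ y j n
    · simp [h, abs_of_nonneg h]
    · simp [h, abs_of_neg (not_le.1 h)]
  have h3 : ∑' n, |y j n| - ∑' n, boolSign (σ n) * y j n ≤ ∑ n ∈ I, 2 * |y j n| := by
    rw [← (hy j).tsum_sub (hsum σ j), tsum_eq_sum hoff]
    refine Finset.sum_le_sum fun n _ => ?_
    have := neg_abs_le (boolSign (σ n) * y j n)
    rw [habs] at this
    linarith
  rw [Real.dist_eq, sub_zero, abs_of_nonneg (tsum_nonneg fun n => abs_nonneg _)]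
  linarith

end Schur

/-! ### From failure of order continuity to a weak almost limited operator that is not almost
limited. -/

section Dual

variable {E : Type u} [NormedAddCommGroup E] [Lattice E] [HasSolidNorm E] [IsOrderedAddMonoid E]
  [NormedSpace ℝ E]

theorem sum_abs_apply_le {f : ℕ → StrongDual ℝ E} {g : StrongDual ℝ E} (h0 : ∀ n, 0 ≤ f n)
    (hg : ∀ n, ∑ k ∈ Finset.range n, f k ≤ g) (x : E) (n : ℕ) :
    ∑ k ∈ Finset.range n, |f k x| ≤ g |x| :=
  calc ∑ k ∈ Finset.range n, |f k x| ≤ ∑ k ∈ Finset.range n, f k |x| :=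
        Finset.sum_le_sum fun k _ => abs_apply_le_apply_abs (h0 k) x
    _ = (∑ k ∈ Finset.range n, f k) |x| := by simp
    _ ≤ g |x| := hg n |x| (abs_nonneg x)

theorem summable_abs_apply {f : ℕ → StrongDual ℝ E} {g : StrongDual ℝ E} (h0 : ∀ n, 0 ≤ f n)
    (hg : ∀ n, ∑ k ∈ Finset.range n, f k ≤ g) (x : E) : Summable fun n => |f n x| :=
  summable_of_sum_range_le (fun _ => abs_nonneg _) (sum_abs_apply_le h0 hg x)

/-- The operator `x ↦ ∑ f_n(x) a_n` for a bounded sequence `(a_n)`. -/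
theorem exists_hasSum_operator {F : Type*} [NormedAddCommGroup F] [NormedSpace ℝ F]
    [CompleteSpace F] {f : ℕ → StrongDual ℝ E} {g : StrongDual ℝ E} (h0 : ∀ n, 0 ≤ f n)
    (hg : ∀ n, ∑ k ∈ Finset.range n, f k ≤ g) {a : ℕ → F} (ha : ∀ n, ‖a n‖ ≤ 1) :
    ∃ S : E →L[ℝ] F, ∀ x, HasSum (fun n => f n x • a n) (S x) := by
  have hle : ∀ x n, ‖f n x • a n‖ ≤ |f n x| := fun x n => by
    rw [norm_smul, Real.norm_eq_abs]
    exact mul_le_of_le_one_right (abs_nonneg _) (ha n)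
  have hs : ∀ x, Summable fun n => f n x • a n := fun x =>
    Summable.of_norm_bounded (summable_abs_apply h0 hg x) (hle x)
  let S : E →ₗ[ℝ] F :=
    { toFun := fun x => ∑' n, f n x • a n
      map_add' := fun x y => by
        rw [← (hs x).tsum_add (hs y)]
        simp only [map_add, add_smul]
      map_smul' := fun c x => by
        rw [RingHom.id_apply, ← (hs x).tsum_const_smul c]
        simp only [map_smul, smul_smul, smul_eq_mul] }
  refine ⟨S.mkContinuous ‖g‖ fun x => ?_, fun x => (hs x).hasSum⟩
  refine (tsum_of_norm_bounded (summable_abs_apply h0 hg x).hasSum (hle x)).trans ?_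
  refine (Real.tsum_le_of_sum_range_le (fun _ => abs_nonneg _) (sum_abs_apply_le h0 hg x)).trans ?_
  refine (le_abs_self _).trans ((g.le_opNorm _).trans ?_)
  rw [norm_abs_eq_norm]

theorem tendsto_ultrafilter_eval {X : Type u} [NormedAddCommGroup X] [NormedSpace ℝ X]
    {K : Set (WeakSpace ℝ X)} (hK : IsCompact K) {w : ℕ → X} (hw : ∀ n, toWeakSpace ℝ X (w n) ∈ K)
    (U : Ultrafilter ℕ) :
    ∃ v : X, ∀ h : StrongDual ℝ X, Tendsto (fun n => h (w n)) U (𝓝 (h v)) := by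
  obtain ⟨v, -, hv⟩ := isCompact_iff_ultrafilter_le_nhds.1 hK
    (U.map fun n => toWeakSpace ℝ X (w n)) (by
      rw [Ultrafilter.coe_map, le_principal_iff]
      exact Filter.mem_map.2 (Filter.univ_mem' hw))
  refine ⟨(toWeakSpace ℝ X).symm v, fun h => ?_⟩
  exact ((WeakBilin.eval_continuous (topDualPairing ℝ X).flip h).tendsto v).comp hv

/-- A relatively weakly compact set has uniformly small tails with respect to a sequence of
positive functionals with bounded partial sums. -/
theorem exists_uniform_tail {f : ℕ → StrongDual ℝ E} {g : StrongDual ℝ E} (h0 : ∀ n, 0 ≤ f n)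
    (hg : ∀ n, ∑ k ∈ Finset.range n, f k ≤ g) {W : Set E} (hW : IsRelWeaklyCompact W) {ε : ℝ}
    (hε : 0 < ε) : ∃ N, ∀ w ∈ W, ∑' n, |f (n + N) w| ≤ ε := by
  by_contra! hcon
  choose w hwW hw using hcon
  have hwK : ∀ n, toWeakSpace ℝ E (w n) ∈ closure (toWeakSpace ℝ E '' W) := fun n =>
    subset_closure ⟨w n, hwW n, rfl⟩
  -- The image of the weakly compact closure in `ℝ^ℕ` is metrizable, so a subsequence converges
  -- coordinatewise without any sequential compactness of the weak topology.
  let Φ : WeakSpace ℝ E → ℕ → ℝ := fun v n => (topDualPairing ℝ E).flip v (f n)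
  have hΦ : Continuous Φ := continuous_pi fun n =>
    WeakBilin.eval_continuous (topDualPairing ℝ E).flip (f n)
  obtain ⟨_, ⟨v, -, rfl⟩, θ, hθ, hlim⟩ := (IsCompact.image hW hΦ).tendsto_subseq
    (x := fun n => Φ (toWeakSpace ℝ E (w n))) fun n => ⟨_, hwK n, rfl⟩
  set v' : E := (toWeakSpace ℝ E).symm v with hv'
  have hlim' : ∀ n, Tendsto (fun j => f n (w (θ j))) atTop (𝓝 (f n v')) :=
    tendsto_pi_nhds.1 hlim
  have key : Tendsto (fun j => ∑' n, |f n (w (θ j) - v')|) atTop (𝓝 0) := by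
    refine tendsto_tsum_abs_of_signed (fun j => summable_abs_apply h0 hg _) (fun n => ?_)
      fun σ => ?_
    · simpa using (hlim' n).sub_const (f n v')
    · obtain ⟨S, hS⟩ := exists_hasSum_operator h0 hg (a := fun n => boolSign (σ n))
        fun n => (abs_boolSign _).le
      have hS' : ∀ x, ∑' n, boolSign (σ n) * f n x = S x := fun x => by
        rw [← (hS x).tsum_eq]
        simp only [smul_eq_mul, mul_comm]
      simp only [hS']
      -- Weak limits along different ultrafilters may differ, but all have the coordinates `f n v'`,
      -- and `S` depends only on these.
      rw [tendsto_iff_ultrafilter]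
      intro U hU
      obtain ⟨z, hz⟩ := tendsto_ultrafilter_eval hW (fun n => hwK (θ n)) U
      have hzv : S z = S v' := by
        rw [← hS' z, ← hS' v']
        congr 1
        funext n
        rw [tendsto_nhds_unique (hz (f n)) ((hlim' n).mono_left hU)]
      have := (hz S).sub_const (S v')
      rw [hzv, sub_self] at this
      simpa only [map_sub] using this
  have htail : Tendsto (fun j => ∑' n, |f (n + θ j) v'|) atTop (𝓝 0) :=
    (tendsto_sum_nat_add fun n => |f n v'|).comp hθ.tendsto_atTop
  have hsum := key.add htail
  rw [add_zero] at hsum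
  refine absurd (ge_of_tendsto' hsum fun j => ?_) (not_le.2 hε)
  refine (hw (θ j)).le.trans ?_
  have hs1 := summable_abs_apply h0 hg (w (θ j) - v')
  have hs2 := summable_abs_apply h0 hg v'
  have hs1' := (summable_nat_add_iff (θ j)).2 hs1
  have hs2' := (summable_nat_add_iff (θ j)).2 hs2
  have hs3' := (summable_nat_add_iff (θ j)).2 (summable_abs_apply h0 hg (w (θ j)))
  calc ∑' n, |f (n + θ j) (w (θ j))|
      ≤ ∑' n, (|f (n + θ j) (w (θ j) - v')| + |f (n + θ j) v'|) :=
        hs3'.tsum_le_tsum (fun n => by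
          have := abs_add_le (f (n + θ j) (w (θ j) - v')) (f (n + θ j) v')
          rwa [← map_add, sub_add_cancel] at this) (hs1'.add hs2')
    _ = ∑' n, |f (n + θ j) (w (θ j) - v')| + ∑' n, |f (n + θ j) v'| := hs1'.tsum_add hs2'
    _ ≤ ∑' n, |f n (w (θ j) - v')| + ∑' n, |f (n + θ j) v'| := by
        refine add_le_add_left ?_ _
        rw [← hs1.sum_add_tsum_nat_add (θ j)]
        exact le_add_of_nonneg_left (Finset.sum_nonneg fun _ _ => abs_nonneg _)

theorem exists_forall_le_norm {ι : Type*} [Preorder ι] {φ : ι → StrongDual ℝ E}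
    (hφ : Antitone φ) (h0 : ∀ i, 0 ≤ φ i) (h : ¬Tendsto (fun i => ‖φ i‖) atTop (𝓝 0))
    [IsDirectedOrder ι] [Nonempty ι] : ∃ ε > 0, ∀ i, ε ≤ ‖φ i‖ := by
  by_contra! hcon
  refine h (Metric.tendsto_nhds.2 fun ε hε => ?_)
  obtain ⟨i, hi⟩ := hcon ε hε
  filter_upwards [eventually_ge_atTop i] with j hj
  rw [Real.dist_eq, sub_zero, abs_norm]
  exact (dual_norm_mono (h0 j) (hφ hj)).trans_lt hi

theorem le_norm_of_nsmul_le {f g R : StrongDual ℝ E} {N : ℕ} {ε : ℝ} (hf : 0 ≤ f)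
    (h : N • f ≤ g + N • R) (hfε : ε ≤ ‖f‖) (hN0 : (0 : ℝ) < N) (hN : ‖g‖ < N * (ε / 2)) :
    ε / 2 ≤ ‖R‖ := by
  have h2 := (dual_norm_mono (nsmul_nonneg hf N) h).trans (norm_add_le _ _)
  rw [← Nat.cast_smul_eq_nsmul ℝ, ← Nat.cast_smul_eq_nsmul ℝ, norm_smul, norm_smul,
    Real.norm_of_nonneg hN0.le] at h2
  have h3 : (N : ℝ) * ε ≤ N * ‖f‖ := mul_le_mul_of_nonneg_left hfε hN0.le
  have h4 : (N : ℝ) * (ε / 2) ≤ N * ‖R‖ := by linarith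
  exact le_of_mul_le_mul_left h4 hN0

/-- In a net of positive functionals tending to zero pointwise, some later difference nearly has
the norm of a given member. -/
theorem exists_le_norm_sub {ι : Type*} [Preorder ι] [IsDirectedOrder ι] [Nonempty ι]
    {R : ι → StrongDual ℝ E} (h0 : ∀ i, 0 ≤ R i)
    (hR : ∀ x, 0 ≤ x → Tendsto (fun i => R i x) atTop (𝓝 0)) {ε : ℝ} (hε : 0 < ε) {a : ι}
    (ha : ε < ‖R a‖) : ∃ b, a ≤ b ∧ ε / 2 ≤ ‖R a - R b‖ := by
  obtain ⟨x, hx0, hx1, hx⟩ := exists_nonneg_lt_apply (h0 a) ha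
  obtain ⟨b, hab, hb⟩ := ((eventually_ge_atTop a).and
    ((hR x hx0).eventually_lt_const (half_pos hε))).exists
  refine ⟨b, hab, ?_⟩
  have h2 : (R a - R b) x ≤ ‖R a - R b‖ * ‖x‖ :=
    (le_abs_self _).trans ((R a - R b).le_opNorm x)
  have h3 : ‖R a - R b‖ * ‖x‖ ≤ ‖R a - R b‖ := mul_le_of_le_one_right (norm_nonneg _) hx1
  rw [sub_apply] at h2
  linarith

/-- A net decreasing to zero but bounded away from zero in norm can be replaced, eventually, by
components of a fixed functional. -/
theorem exists_components_of_isGLB {ι : Type*} [Preorder ι] [IsDirectedOrder ι] [Nonempty ι]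
    {φ : ι → StrongDual ℝ E} (hφ : Antitone φ) (hglb : IsGLB (Set.range φ) 0) (i₀ : ι) {ε : ℝ}
    (hε : 0 < ε) (hφε : ∀ i, ε ≤ ‖φ i‖) :
    ∃ R h : ι → StrongDual ℝ E, (∀ i, 0 ≤ h i) ∧ (∀ i, IsBandComponent (φ i₀) (h i) (R i)) ∧
      Antitone R ∧ (∀ x, 0 ≤ x → Tendsto (fun i => R i x) atTop (𝓝 0)) ∧
      ∀ i, i₀ ≤ i → ε / 2 ≤ ‖R i‖ := by
  have h0 : ∀ i, 0 ≤ φ i := fun i => hglb.1 ⟨i, rfl⟩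
  -- `N` makes the loss `‖φ i₀‖ / N` in passing from `φ i` to its component smaller than `ε / 2`.
  obtain ⟨N, hN⟩ := exists_nat_gt (‖φ i₀‖ / (ε / 2))
  have hN0 : (0 : ℝ) < N := lt_of_le_of_lt (by positivity) hN
  rw [div_lt_iff₀ (half_pos hε)] at hN
  choose R hR using fun i => exists_isBandComponent (h0 i₀) (posPart_nonneg (N • φ i - φ i₀))
  refine ⟨R, fun i => (N • φ i - φ i₀)⁺, fun i => posPart_nonneg _, hR, fun i j hij => ?_,
    fun x hx => ?_, fun i hi => ?_⟩
  · exact (hR j).mono (hR i)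
      (posPart_mono (sub_le_sub_right (nsmul_le_nsmul_right (hφ hij) N) (φ i₀)))
  · have ht := ((tendsto_zero_of_isGLB hφ hglb hx).const_mul (N : ℝ))
    rw [mul_zero] at ht
    refine squeeze_zero (fun i => (hR i).nonneg (h0 i₀) x hx) (fun i => ?_) ht
    simpa using (hR i).le_nsmul (h0 i) x hx
  · exact le_norm_of_nsmul_le (h0 i) ((hR i).nsmul_le (h0 i) (hφ hi)) (hφε i) hN0 hN

/-- If the norm of the dual is not order continuous, then some order bounded disjoint sequence in
the dual is bounded away from zero. -/
theorem exists_disjoint_of_not_hasOrderContinuousNorm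
    (h : ¬HasOrderContinuousNorm (StrongDual ℝ E)) :
    ∃ (f : ℕ → StrongDual ℝ E) (g : StrongDual ℝ E) (ε : ℝ), 0 < ε ∧ (∀ n, 0 ≤ f n) ∧
      (Pairwise fun n m => f n ⊓ f m = 0) ∧ (∀ n, f n ≤ g) ∧ ∀ n, ε ≤ ‖f n‖ := by
  unfold HasOrderContinuousNorm at h
  push Not at h
  obtain ⟨ι, _, _, _, φ, hφ, hglb, hnt⟩ := h
  have h0 : ∀ i, 0 ≤ φ i := fun i => hglb.1 ⟨i, rfl⟩
  obtain ⟨ε, hε, hφε⟩ := exists_forall_le_norm hφ h0 hnt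
  let i₀ : ι := Classical.arbitrary ι
  obtain ⟨R, h, hh, hR, hRanti, hRlim, hRnorm⟩ := exists_components_of_isGLB hφ hglb i₀ hε hφε
  have hR0 : ∀ i, 0 ≤ R i := fun i => (hR i).nonneg (h0 i₀)
  -- The bound `ε / 2 ≤ ‖R a‖` is known only beyond `i₀`; the value `ε / 4` supplies the strict
  -- inequality needed to find `b`.
  have hstep : ∀ a : Set.Ici i₀, ∃ b : Set.Ici i₀, a ≤ b ∧ ε / 4 / 2 ≤ ‖R a - R b‖ := by
    rintro ⟨a, ha⟩
    obtain ⟨b, hab, hb⟩ := exists_le_norm_sub hR0 hRlim (ε := ε / 4) (by positivity)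
      (lt_of_lt_of_le (by linarith) (hRnorm a ha))
    exact ⟨⟨b, le_trans ha hab⟩, hab, hb⟩
  obtain ⟨s, -, hs⟩ := exists_seq_rel_succ hstep ⟨i₀, le_rfl⟩
  have hsm : Monotone s := monotone_nat_of_le_succ fun k => (hs k).1
  have hRs : Antitone fun k => R (s k) := fun j k hjk => hRanti (hsm hjk)
  exact ⟨fun k => R (s k) - R (s (k + 1)), φ i₀, ε / 4 / 2, by positivity,
    fun k => sub_nonneg.2 (hRs k.le_succ),
    IsBandComponent.pairwise_inf_sub_eq_zero (fun k => hR (s k)) (h0 i₀) (fun k => hh _) hRs,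
    fun k => (sub_le_self _ (hR0 _)).trans (hR _).le, fun k => (hs k).2⟩

theorem isDisjointSeq_of_nonneg {f : ℕ → StrongDual ℝ E} (h0 : ∀ n, 0 ≤ f n)
    (hd : Pairwise fun n m => f n ⊓ f m = 0) : IsDisjointSeq f := fun n m hnm => by
  change |f n| ⊓ |f m| = 0
  rw [abs_of_nonneg (h0 n), abs_of_nonneg (h0 m)]
  exact hd hnm

theorem exists_norm_le_of_isWeakStarNull {X : Type u} [NormedAddCommGroup X] [NormedSpace ℝ X]
    [CompleteSpace X] {h : ℕ → StrongDual ℝ X} (hh : IsWeakStarNull h) : ∃ B, ∀ n, ‖h n‖ ≤ B := by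
  refine banach_steinhaus fun x => ?_
  obtain ⟨B, hB⟩ := (isWeakStarNull_iff.1 hh x).norm.bddAbove_range
  exact ⟨B, fun n => hB ⟨n, rfl⟩⟩

/-- An operator `x ↦ ∑ f_n(x) a_n` factoring through `ℓ¹` is weak almost limited. -/
theorem isWeakAlmostLimited_of_hasSum [CompleteSpace E] {f : ℕ → StrongDual ℝ E}
    {g : StrongDual ℝ E} (h0 : ∀ n, 0 ≤ f n) (hg : ∀ n, ∑ k ∈ Finset.range n, f k ≤ g)
    {x : ℕ → E} (hx1 : ∀ n, ‖x n‖ ≤ 1) {T : E →L[ℝ] E}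
    (hT : ∀ z, HasSum (fun n => f n z • x n) (T z)) : IsWeakAlmostLimited T := by
  intro W hW
  have hsum := summable_abs_apply h0 hg
  have happ : ∀ (h : StrongDual ℝ E) z, HasSum (fun n => f n z * h (x n)) (h (T z)) :=
    fun h z => by simpa using (hT z).mapL h
  have hb : ∀ n, ∃ C, ∀ w ∈ W, |f n w| ≤ C := fun n => by
    obtain ⟨C, hC⟩ := (IsCompact.image hW (WeakBilin.eval_continuous
      (topDualPairing ℝ E).flip (f n))).isBounded.exists_norm_le
    exact ⟨C, fun w hw => hC _ ⟨toWeakSpace ℝ E w, subset_closure ⟨w, hw, rfl⟩, rfl⟩⟩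
  choose C hC using hb
  constructor
  · obtain ⟨N, hN⟩ := exists_uniform_tail h0 hg hW one_pos
    refine (isBounded_iff_forall_norm_le).2 ⟨∑ n ∈ Finset.range N, C n + 1, ?_⟩
    rintro _ ⟨w, hw, rfl⟩
    have h1 : ‖T w‖ ≤ ∑' n, |f n w| := by
      rw [← (hT w).tsum_eq]
      refine tsum_of_norm_bounded (hsum w).hasSum fun n => ?_
      rw [norm_smul, Real.norm_eq_abs]
      exact mul_le_of_le_one_right (abs_nonneg _) (hx1 n)
    rw [← (hsum w).sum_add_tsum_nat_add N] at h1
    exact h1.trans (add_le_add (Finset.sum_le_sum fun n _ => hC n w hw) (hN w hw))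
  · intro h _ hnull
    obtain ⟨B, hB⟩ := exists_norm_le_of_isWeakStarNull hnull
    rw [isWeakStarNull_iff] at hnull
    have hB0 : 0 ≤ B := (norm_nonneg _).trans (hB 0)
    have hhx : ∀ k n, |h k (x n)| ≤ B := fun k n =>
      ((h k).le_opNorm_of_le (hx1 n)).trans (by simpa using hB k)
    rw [Metric.tendstoUniformlyOn_iff]
    intro δ hδ
    -- The tail contributes at most `B` times this, hence at most `δ / 2`; `B + 1` avoids dividing
    -- by zero.
    obtain ⟨N, hN⟩ := exists_uniform_tail h0 hg hW (ε := δ / (2 * (B + 1))) (by positivity)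
    have hfin : Tendsto (fun k => ∑ n ∈ Finset.range N, C n * |h k (x n)|) atTop (𝓝 0) := by
      simpa using tendsto_finsetSum (Finset.range N) fun n _ => (hnull (x n)).abs.const_mul (C n)
    filter_upwards [hfin.eventually_lt_const (half_pos hδ)] with k hk
    rintro _ ⟨w, hw, rfl⟩
    rw [dist_comm, Real.dist_eq, sub_zero]
    have hle : ∀ n, |f n w * h k (x n)| ≤ B * |f n w| := fun n => by
      rw [abs_mul, mul_comm |f n w|]
      exact mul_le_mul_of_nonneg_right (hhx k n) (abs_nonneg _)
    have hs1 : Summable fun n => |f n w * h k (x n)| :=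
      Summable.of_nonneg_of_le (fun _ => abs_nonneg _) hle ((hsum w).mul_left B)
    have h1 := norm_tsum_le_tsum_norm (f := fun n => f n w * h k (x n)) hs1
    simp only [(happ (h k) w).tsum_eq, Real.norm_eq_abs] at h1
    rw [← hs1.sum_add_tsum_nat_add N] at h1
    have h2 : ∑ n ∈ Finset.range N, |f n w * h k (x n)|
        ≤ ∑ n ∈ Finset.range N, C n * |h k (x n)| := Finset.sum_le_sum fun n _ => by
      rw [abs_mul]
      exact mul_le_mul_of_nonneg_right (hC n w hw) (abs_nonneg _)
    have h3 : ∑' n, |f (n + N) w * h k (x (n + N))| ≤ B * (δ / (2 * (B + 1))) := by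
      refine (((summable_nat_add_iff N).2 hs1).tsum_le_tsum (fun n => hle (n + N))
        (((summable_nat_add_iff N).2 (hsum w)).mul_left B)).trans ?_
      rw [tsum_mul_left]
      exact mul_le_mul_of_nonneg_left (hN w hw) hB0
    have h4 : B * (δ / (2 * (B + 1))) ≤ δ / 2 := by
      rw [← mul_div_assoc, div_le_div_iff₀ (by positivity) two_pos]
      nlinarith
    linarith

theorem hasOrderContinuousNorm_of_forall_isAlmostLimited [IsOrderedModule ℝ E] [CompleteSpace E]
    (H : ∀ T : E →L[ℝ] E, IsPositiveOperator T → IsWeakAlmostLimited T → IsAlmostLimited T) :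
    HasOrderContinuousNorm (StrongDual ℝ E) := by
  by_contra hoc
  obtain ⟨f, g, ε, hε, h0, hd, hfg, hfε⟩ := exists_disjoint_of_not_hasOrderContinuousNorm hoc
  have hg : ∀ n, ∑ k ∈ Finset.range n, f k ≤ g :=
    sum_le_of_disjoint ((h0 0).trans (hfg 0)) h0 hd hfg
  have hsum := summable_abs_apply h0 hg
  choose x hx0 hx1 hfx using fun n => exists_nonneg_half_norm_le (h0 n)
  obtain ⟨T, hT⟩ := exists_hasSum_operator h0 hg hx1
  have hTpos : IsPositiveOperator T := fun z hz =>
    (hT z).nonneg fun n => smul_nonneg (h0 n z hz) (hx0 n)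
  have hfnull : IsWeakStarNull f := isWeakStarNull_iff.2 fun z =>
    ((hsum z).of_abs).tendsto_atTop_zero
  have happ : ∀ (h : StrongDual ℝ E) z, HasSum (fun n => f n z * h (x n)) (h (T z)) :=
    fun h z => by simpa using (hT z).mapL h
  have hTweak : IsWeakAlmostLimited T := isWeakAlmostLimited_of_hasSum h0 hg hx1 hT
  have hTal := H T hTpos hTweak
  have huni := hTal.2 f (isDisjointSeq_of_nonneg h0 hd) hfnull
  rw [Metric.tendstoUniformlyOn_iff] at huni
  obtain ⟨n, hn⟩ := (huni ((ε / 2) ^ 2) (by positivity)).exists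
  have h1 := hn (T (x n)) ⟨x n, by simpa using hx1 n, rfl⟩
  rw [dist_comm, Real.dist_eq, sub_zero] at h1
  -- The diagonal term of a series with nonnegative terms.
  have h2 : f n (x n) * f n (x n) ≤ f n (T (x n)) :=
    le_hasSum (happ (f n) (x n)) n fun k _ => mul_nonneg (h0 k _ (hx0 n)) (h0 n _ (hx0 k))
  have h3 : ε / 2 ≤ f n (x n) := by linarith [hfε n, hfx n]
  have h4 := le_abs_self (f n (T (x n)))
  nlinarith

end Dual

end BanachLattice

namespace BanachLattice

/-! ### Disjoint sequences in `E`: weak nullity and disjointification. -/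

section Dual

variable {E : Type u} [NormedAddCommGroup E] [Lattice E] [HasSolidNorm E] [IsOrderedAddMonoid E]
  [NormedSpace ℝ E]

/-- The component `x ↦ sup_m φ(x ⊓ m y)` of a positive functional. -/
theorem exists_component_functional {φ : StrongDual ℝ E} (hφ : 0 ≤ φ) {y : E} (hy : 0 ≤ y) :
    ∃ ψ : StrongDual ℝ E, ∀ x, 0 ≤ x →
      Tendsto (fun m : ℕ => φ (x ⊓ m • y)) atTop (𝓝 (ψ x)) := by
  have hmono : ∀ x : E, Monotone fun m : ℕ => φ (x ⊓ m • y) := fun x m n hmn =>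
    dual_monotone hφ (inf_le_inf_left _ (nsmul_le_nsmul_left hy hmn))
  have hlim : ∀ x : E, Tendsto (fun m : ℕ => φ (x ⊓ m • y)) atTop (𝓝 (⨆ m : ℕ, φ (x ⊓ m • y))) :=
    fun x => tendsto_atTop_ciSup (hmono x)
      ⟨φ x, by rintro _ ⟨m, rfl⟩; exact dual_monotone hφ inf_le_left⟩
  have hny : ∀ m : ℕ, 0 ≤ m • y := fun m => nsmul_nonneg hy m
  have hadd : ∀ x x' : E, 0 ≤ x → 0 ≤ x' → (⨆ m : ℕ, φ ((x + x') ⊓ m • y)) =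
      (⨆ m : ℕ, φ (x ⊓ m • y)) + ⨆ m : ℕ, φ (x' ⊓ m • y) := fun x x' hx hx' => by
    have hsum := (hlim x).add (hlim x')
    apply le_antisymm
    · refine le_of_tendsto_of_tendsto' (hlim (x + x')) hsum fun m => ?_
      rw [← map_add]
      refine dual_monotone hφ ?_
      rw [inf_comm, inf_comm x, inf_comm x']
      exact inf_add_le_inf_add_inf (hny m) hx hx'
    · refine le_of_tendsto' hsum fun m => ?_
      -- The two truncations at `m y` add up to something below `2m y`, hence the index `m + m`.
      refine le_trans ?_ ((hmono (x + x')).ge_of_tendsto (hlim (x + x')) (m + m))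
      rw [← map_add, add_nsmul]
      exact dual_monotone hφ (le_inf (add_le_add inf_le_left inf_le_left)
        (add_le_add inf_le_right inf_le_right))
  obtain ⟨ψ, hψ⟩ := exists_dual_of_additive (fun x => ⨆ m : ℕ, φ (x ⊓ m • y)) ‖φ‖ hadd
    (fun x hx => Real.iSup_nonneg fun m => hφ _ (le_inf hx (hny m)))
    (fun x hx => ciSup_le fun m => (dual_monotone hφ inf_le_left).trans
      ((le_abs_self _).trans (φ.le_opNorm x)))
  exact ⟨ψ, fun x hx => by rw [hψ x hx]; exact hlim x⟩

theorem nsmul_inf_nsmul_eq_zero {a b : E} (ha : 0 ≤ a) (hb : 0 ≤ b) (h : a ⊓ b = 0) (m n : ℕ) :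
    m • a ⊓ n • b = 0 := by
  refine le_antisymm ?_ (le_inf (nsmul_nonneg ha m) (nsmul_nonneg hb n))
  refine (inf_nsmul_le_nsmul_inf (nsmul_nonneg ha m) hb n).trans (nsmul_nonpos ?_ n)
  rw [inf_comm]
  refine (inf_nsmul_le_nsmul_inf hb ha m).trans (nsmul_nonpos ?_ m)
  rw [inf_comm, h]

/-- The components of a positive functional along disjoint vectors have partial sums bounded by
the functional. -/
theorem exists_disjoint_components {φ : StrongDual ℝ E} (hφ : 0 ≤ φ) {y : ℕ → E}
    (hy : ∀ k, 0 ≤ y k) (hd : Pairwise fun i j => y i ⊓ y j = 0) :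
    ∃ ψ : ℕ → StrongDual ℝ E, (∀ k, 0 ≤ ψ k) ∧ (∀ n, ∑ k ∈ Finset.range n, ψ k ≤ φ) ∧
      ∀ k, φ (y k) ≤ ψ k (y k) := by
  choose ψ hψ using fun k => exists_component_functional hφ (hy k)
  have hny : ∀ (m k : ℕ), 0 ≤ m • y k := fun m k => nsmul_nonneg (hy k) m
  refine ⟨ψ, fun k x hx => ?_, fun n x hx => ?_, fun k => ?_⟩
  · exact ge_of_tendsto' (hψ k x hx) fun m => hφ _ (le_inf hx (hny m k))
  · have h1 := tendsto_finsetSum (Finset.range n) fun k _ => hψ k x hx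
    rw [sum_apply]
    refine le_of_tendsto' h1 fun m => ?_
    rw [← map_sum]
    refine dual_monotone hφ (sum_le_of_disjoint hx (fun k => le_inf hx (hny m k))
      (fun i j hij => ?_) (fun k => inf_le_left) n)
    exact inf_eq_zero_of_le (le_inf hx (hny m i)) (le_inf hx (hny m j)) inf_le_right inf_le_right
      (nsmul_inf_nsmul_eq_zero (hy i) (hy j) (hd hij) m m)
  · refine ge_of_tendsto (hψ k (y k) (hy k)) ?_
    filter_upwards [eventually_ge_atTop 1] with m hm
    rw [inf_eq_left.2]
    simpa using nsmul_le_nsmul_left (hy k) hm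

/-- The partial sums increase to a functional `S`; the remainders decrease to zero, hence in norm,
and the `n`-th remainder dominates `ψ n`. -/
theorem tendsto_norm_zero_of_sum_le (hoc : HasOrderContinuousNorm (StrongDual ℝ E))
    {ψ : ℕ → StrongDual ℝ E} {φ : StrongDual ℝ E} (h0 : ∀ k, 0 ≤ ψ k)
    (hφ : ∀ n, ∑ k ∈ Finset.range n, ψ k ≤ φ) : Tendsto (fun n => ‖ψ n‖) atTop (𝓝 0) := by
  have hm : Monotone fun n => ∑ k ∈ Finset.range n, ψ k :=
    monotone_nat_of_le_succ fun n => by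
      rw [Finset.sum_range_succ]; exact le_add_of_nonneg_right (h0 n)
  obtain ⟨S, hS⟩ := exists_dual_tendsto_of_monotone hm
    (fun n => Finset.sum_nonneg fun k _ => h0 k) hφ
  have hlub := isLUB_of_tendsto hm hS
  have hanti : Antitone fun n => S - ∑ k ∈ Finset.range n, ψ k := fun m n hmn =>
    sub_le_sub_left (hm hmn) S
  have hlim : ∀ x : E, 0 ≤ x →
      Tendsto (fun n => (S - ∑ k ∈ Finset.range n, ψ k) x) atTop (𝓝 0) := fun x hx => by
    simpa only [sub_apply, sub_self] using (hS x hx).const_sub (S x)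
  have hglb := isGLB_zero_of_tendsto hanti hlim
  -- Order continuity is stated for index types in the universe of `E`, so `ℕ` is lifted.
  have hnorm := hoc (ULift.{u} ℕ) (fun n => S - ∑ k ∈ Finset.range n.down, ψ k)
    (fun m n hmn => hanti hmn) (by
      convert hglb using 1
      exact (Equiv.ulift.surjective.range_comp fun n => S - ∑ k ∈ Finset.range n, ψ k))
  have hup : Tendsto (ULift.up.{u} : ℕ → ULift ℕ) atTop atTop :=
    tendsto_atTop.2 fun b => (eventually_ge_atTop b.down).mono fun n hn => hn
  refine squeeze_zero (fun n => norm_nonneg _) (fun n => ?_) (hnorm.comp hup)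
  refine dual_norm_mono (h0 n) ?_
  rw [le_sub_iff_add_le, add_comm, ← Finset.sum_range_succ]
  exact hlub.1 ⟨n + 1, rfl⟩

/-- If the norm of the dual is order continuous, bounded disjoint positive sequences are weakly
null. -/
theorem tendsto_apply_of_disjoint (hoc : HasOrderContinuousNorm (StrongDual ℝ E)) {y : ℕ → E}
    (hy : ∀ k, 0 ≤ y k) (hy1 : ∀ k, ‖y k‖ ≤ 1) (hd : Pairwise fun i j => y i ⊓ y j = 0)
    (h : StrongDual ℝ E) : Tendsto (fun k => h (y k)) atTop (𝓝 0) := by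
  obtain ⟨ψ, h0, hsum, hle⟩ := exists_disjoint_components (abs_nonneg h) hy hd
  refine squeeze_zero_norm (fun k => ?_) (tendsto_norm_zero_of_sum_le hoc h0 hsum)
  calc ‖h (y k)‖ ≤ (|h| : StrongDual ℝ E) |y k| := abs_apply_le_abs h (y k)
    _ = (|h| : StrongDual ℝ E) (y k) := by rw [abs_of_nonneg (hy k)]
    _ ≤ ψ k (y k) := hle k
    _ ≤ ‖ψ k (y k)‖ := le_abs_self _
    _ ≤ ‖ψ k‖ := (ψ k).le_of_opNorm_le_of_le le_rfl (hy1 k) |>.trans (mul_one _).le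

theorem isRelWeaklyCompact_range {X : Type u} [NormedAddCommGroup X] [NormedSpace ℝ X] {y : ℕ → X}
    (h : ∀ f : StrongDual ℝ X, Tendsto (fun k => f (y k)) atTop (𝓝 0)) :
    IsRelWeaklyCompact (Set.range y) := by
  have ht : Tendsto (fun k => toWeakSpace ℝ X (y k)) atTop (𝓝 0) := by
    refine (Topology.IsInducing.tendsto_nhds_iff
      (f := fun k => toWeakSpace ℝ X (y k)) (g := fun (v : WeakSpace ℝ X) (f : StrongDual ℝ X) =>
        (topDualPairing ℝ X).flip v f) ⟨rfl⟩).2 (tendsto_pi_nhds.2 fun f => ?_)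
    have hf : Tendsto (fun k => f (y k)) atTop (𝓝 (f 0)) := by rw [map_zero]; exact h f
    exact hf
  refine ht.isCompact_insert_range.closure_of_subset ?_
  rw [← Set.range_comp]
  exact Set.subset_insert _ _

/-- Disjointification of a bounded positive sequence. -/
theorem pairwise_disjoint_posPart [IsOrderedModule ℝ E] {x : ℕ → E} {z : E} (hx : ∀ k, 0 ≤ x k)
    (hz : ∀ k, (1 / 2 : ℝ) ^ k • x k ≤ z) :
    Pairwise fun i j =>
      (x (i + 1) - (4 : ℝ) ^ i • ∑ k ∈ Finset.range (i + 1), x k - (1 / 2 : ℝ) ^ i • z)⁺ ⊓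
      (x (j + 1) - (4 : ℝ) ^ j • ∑ k ∈ Finset.range (j + 1), x k - (1 / 2 : ℝ) ^ j • z)⁺ = 0 := by
  have hz0 : 0 ≤ z := (smul_nonneg (by positivity) (hx 0)).trans (hz 0)
  have hsum : ∀ n, 0 ≤ ∑ k ∈ Finset.range n, x k := fun n => Finset.sum_nonneg fun k _ => hx k
  have key : ∀ i j, i < j →
      (x (i + 1) - (4 : ℝ) ^ i • ∑ k ∈ Finset.range (i + 1), x k - (1 / 2 : ℝ) ^ i • z)⁺ ⊓
      (x (j + 1) - (4 : ℝ) ^ j • ∑ k ∈ Finset.range (j + 1), x k - (1 / 2 : ℝ) ^ j • z)⁺ = 0 := by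
    intro i j hij
    have h4 : (1 : ℝ) ≤ 4 ^ j := one_le_pow₀ (by norm_num)
    -- With `a = 4^j x_{i+1} - x_{j+1}`, the first term is at most `a⁺` and the second at most `a⁻`.
    refine inf_eq_zero_of_le (posPart_nonneg _) (posPart_nonneg _) ?_ ?_
      (posPart_inf_negPart_eq_zero ((4 : ℝ) ^ j • x (i + 1) - x (j + 1)))
    · have h1 : x (i + 1) - (4 : ℝ) ^ i • ∑ k ∈ Finset.range (i + 1), x k - (1 / 2 : ℝ) ^ i • z ≤
          ((4 : ℝ) ^ j)⁻¹ • ((4 : ℝ) ^ j • x (i + 1) - x (j + 1)) := by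
        rw [smul_sub, inv_smul_smul₀ (by positivity), sub_sub]
        refine sub_le_sub_left ?_ _
        have h2 : ((4 : ℝ) ^ j)⁻¹ • x (j + 1) ≤ (1 / 2 : ℝ) ^ i • z := by
          refine le_trans ?_ (smul_le_smul_of_nonneg_left (hz (j + 1)) (by positivity))
          rw [smul_smul]
          refine smul_le_smul_of_nonneg_right ?_ (hx _)
          -- The exponents compare as `i + (j + 1) ≤ 2j`, which is where `i < j` and the base `4 =
          -- 2²` are used.
          rw [← pow_add, ← inv_pow, show (4 : ℝ)⁻¹ = (1 / 2) ^ 2 by norm_num, ← pow_mul]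
          exact pow_le_pow_of_le_one (by norm_num) (by norm_num) (by omega)
        exact h2.trans (le_add_of_nonneg_left (smul_nonneg (by positivity) (hsum _)))
      refine (posPart_mono h1).trans ?_
      rw [posPart_def]
      refine sup_le ?_ (posPart_nonneg _)
      refine (smul_le_smul_of_nonneg_left (le_posPart _) (by positivity)).trans ?_
      exact smul_le_of_le_one_left (posPart_nonneg _) (inv_le_one_of_one_le₀ h4)
    · rw [← posPart_neg, neg_sub]
      refine posPart_mono ?_
      refine (sub_le_self _ (smul_nonneg (by positivity) hz0)).trans (sub_le_sub_left ?_ _)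
      refine smul_le_smul_of_nonneg_left ?_ (by positivity)
      exact Finset.single_le_sum (f := x) (fun k _ => hx k) (Finset.mem_range.2 (by omega))
  intro i j hij
  rcases hij.lt_or_gt with h | h
  · exact key i j h
  · rw [inf_comm]; exact key j i h

end Dual

end BanachLattice

namespace BanachLattice

/-! ### Norm convergence tested on disjoint sequences, and the forward implication. -/

section Dual

variable {E : Type u} [NormedAddCommGroup E] [Lattice E] [HasSolidNorm E] [IsOrderedAddMonoid E]
  [NormedSpace ℝ E]

theorem exists_upper_bound_geometric [CompleteSpace E] [IsOrderedModule ℝ E] {x : ℕ → E}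
    (hx : ∀ k, 0 ≤ x k) (hx1 : ∀ k, ‖x k‖ ≤ 1) : ∃ z, ∀ k, (1 / 2 : ℝ) ^ k • x k ≤ z := by
  have hs : Summable fun k => (1 / 2 : ℝ) ^ k • x k :=
    Summable.of_norm_bounded summable_geometric_two fun k => by
      rw [norm_smul, Real.norm_of_nonneg (by positivity)]
      exact mul_le_of_le_one_right (by positivity) (hx1 k)
  exact ⟨_, fun k => hs.le_tsum k fun j _ => smul_nonneg (by positivity) (hx j)⟩

/-- A pointwise null sequence of positive functionals `(g_n)` is norm null when it tends to zero
uniformly on every disjoint positive sequence in the unit ball. -/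
theorem tendsto_norm_zero_of_disjoint [CompleteSpace E] [IsOrderedModule ℝ E]
    {g : ℕ → StrongDual ℝ E} (h0 : ∀ n, 0 ≤ g n) (hg : ∀ x, Tendsto (fun n => g n x) atTop (𝓝 0))
    (hd : ∀ y : ℕ → E, (∀ k, 0 ≤ y k) → (∀ k, ‖y k‖ ≤ 1) → (Pairwise fun i j => y i ⊓ y j = 0) →
      ∀ ε > 0, ∀ᶠ n in atTop, ∀ k, g n (y k) < ε) :
    Tendsto (fun n => ‖g n‖) atTop (𝓝 0) := by
  by_contra hcon
  obtain ⟨ε, hε, hfreq⟩ : ∃ ε > 0, ∀ N, ∃ n ≥ N, ε ≤ ‖g n‖ := by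
    by_contra! h
    refine hcon (Metric.tendsto_atTop.2 fun ε hε => ?_)
    obtain ⟨N, hN⟩ := h ε hε
    exact ⟨N, fun n hn => by simpa using hN n hn⟩
  choose x hx0 hx1 hgx using fun n => exists_nonneg_half_norm_le (h0 n)
  -- The sum runs over all indices up to `N`, so the choice depends only on the last index; it
  -- dominates the sum over the subsequence because `k ≤ s k`.
  have hstep : ∀ N, ∃ n, N < n ∧ ε ≤ ‖g n‖ ∧
      g n ((4 : ℝ) ^ N • ∑ k ∈ Finset.range (N + 1), x k) < ε / 8 := fun N => by
    obtain ⟨M, hM⟩ := eventually_atTop.1 ((hg ((4 : ℝ) ^ N • ∑ k ∈ Finset.range (N + 1), x k))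
      |>.eventually_lt_const (show 0 < ε / 8 by positivity))
    obtain ⟨n, hn, hn'⟩ := hfreq (max M (N + 1))
    exact ⟨n, (le_max_right _ _).trans hn, hn', hM n ((le_max_left _ _).trans hn)⟩
  obtain ⟨s, -, hs⟩ := exists_seq_rel_succ hstep 0
  have hsm : StrictMono s := strictMono_nat_of_lt_succ fun k => (hs k).1
  obtain ⟨z, hz⟩ := exists_upper_bound_geometric (fun k => hx0 (s k)) fun k => hx1 (s k)
  have hz0 : 0 ≤ z := (smul_nonneg (by positivity) (hx0 (s 0))).trans (hz 0)
  have hsum : ∀ k, 0 ≤ ∑ i ∈ Finset.range (k + 1), x (s i) := fun k =>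
    Finset.sum_nonneg fun i _ => hx0 _
  have hsumle : ∀ k, (4 : ℝ) ^ k • ∑ i ∈ Finset.range (k + 1), x (s i) ≤
      (4 : ℝ) ^ s k • ∑ i ∈ Finset.range (s k + 1), x i := fun k => by
    refine (smul_le_smul_of_nonneg_right (pow_le_pow_right₀ (by norm_num) (hsm.le_apply))
      (hsum k)).trans (smul_le_smul_of_nonneg_left ?_ (by positivity))
    rw [← Finset.sum_image (f := x) (g := s) fun a _ b _ h => hsm.injective h]
    refine Finset.sum_le_sum_of_subset_of_nonneg (fun i hi => ?_) fun i _ _ => hx0 i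
    obtain ⟨j, hj, rfl⟩ := Finset.mem_image.1 hi
    have := hsm.monotone (Nat.lt_succ_iff.1 (Finset.mem_range.1 hj))
    exact Finset.mem_range.2 (Nat.lt_succ_iff.2 this)
  set y : ℕ → E := fun i => (x (s (i + 1)) -
    (4 : ℝ) ^ i • ∑ k ∈ Finset.range (i + 1), x (s k) - (1 / 2 : ℝ) ^ i • z)⁺ with hy
  have hy0 : ∀ k, 0 ≤ y k := fun k => posPart_nonneg _
  have hyx : ∀ k, y k ≤ x (s (k + 1)) := fun k => by
    simp only [hy, posPart_def]
    refine sup_le ?_ (hx0 _)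
    exact (sub_le_self _ (smul_nonneg (by positivity) hz0)).trans
      (sub_le_self _ (smul_nonneg (by positivity) (hsum k)))
  have hev := hd y hy0 (fun k => (norm_mono (hy0 k) (hyx k)).trans (hx1 _))
    (pairwise_disjoint_posPart (fun k => hx0 (s k)) hz) (ε / 8) (by positivity)
  have hgz := (hg z).eventually_lt_const (show 0 < ε / 8 by positivity)
  obtain ⟨M, hM⟩ := eventually_atTop.1 (hev.and hgz)
  -- `y M` is cut from `x (s (M + 1))`. On the latter `g (s (M + 1))` is at least `ε / 2`; the two
  -- subtracted terms cost less than `ε / 8` each, contradicting `g (s (M + 1)) (y M) < ε / 8`.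
  obtain ⟨h1, h2⟩ := hM (s (M + 1)) (M.le_succ.trans hsm.le_apply)
  have h3 := h1 M
  have h4 : g (s (M + 1)) (x (s (M + 1))) -
      g (s (M + 1)) ((4 : ℝ) ^ M • ∑ i ∈ Finset.range (M + 1), x (s i)) -
      g (s (M + 1)) ((1 / 2 : ℝ) ^ M • z) ≤ g (s (M + 1)) (y M) := by
    rw [← map_sub, ← map_sub]
    exact dual_monotone (h0 _) (le_posPart _)
  have h5 := (dual_monotone (h0 (s (M + 1))) (hsumle M)).trans_lt (hs M).2.2
  have h6 : g (s (M + 1)) ((1 / 2 : ℝ) ^ M • z) ≤ g (s (M + 1)) z :=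
    dual_monotone (h0 _) (smul_le_of_le_one_left hz0 (pow_le_one₀ (by norm_num) (by norm_num)))
  have h7 := hgx (s (M + 1))
  have h8 := (hs M).2.1
  linarith

theorem isAlmostLimited_of_hasOrderContinuousNorm [CompleteSpace E] [IsOrderedModule ℝ E]
    (hd : PropertyD E) (hoc : HasOrderContinuousNorm (StrongDual ℝ E)) {T : E →L[ℝ] E}
    (hT : IsPositiveOperator T) (hTw : IsWeakAlmostLimited T) : IsAlmostLimited T := by
  refine ⟨T.lipschitz.isBounded_image Metric.isBounded_closedBall, fun f hf hfn => ?_⟩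
  have habs := hd f hf hfn
  have hdis : IsDisjointSeq fun n => |f n| := fun n m hnm => by
    change |(|f n|)| ⊓ |(|f m|)| = 0
    rw [abs_abs, abs_abs]
    exact hf hnm
  -- Positivity of `T` gives `|T x| ≤ T |x|`, so the norm of `g n` controls `f n ∘ T` on the whole
  -- unit ball.
  let g : ℕ → StrongDual ℝ E := fun n => (|f n| : StrongDual ℝ E).comp T
  have hg0 : ∀ n, 0 ≤ g n := fun n x hx => abs_nonneg (f n) (T x) (hT x hx)
  have hnorm : Tendsto (fun n => ‖g n‖) atTop (𝓝 0) := by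
    refine tendsto_norm_zero_of_disjoint hg0 (fun x => isWeakStarNull_iff.1 habs (T x))
      fun y hy hy1 hyd ε hε => ?_
    have hW := hTw _ (isRelWeaklyCompact_range (tendsto_apply_of_disjoint hoc hy hy1 hyd))
    have huni := Metric.tendstoUniformlyOn_iff.1 (hW.2 _ hdis habs) ε hε
    filter_upwards [huni] with n hn k
    have h1 := hn (T (y k)) ⟨y k, ⟨k, rfl⟩, rfl⟩
    rw [dist_comm, Real.dist_eq, sub_zero] at h1
    exact (le_abs_self _).trans_lt h1
  rw [Metric.tendstoUniformlyOn_iff]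
  intro ε hε
  filter_upwards [hnorm.eventually_lt_const hε] with n hn
  rintro _ ⟨x, hx, rfl⟩
  rw [dist_comm, Real.dist_eq, sub_zero]
  have hx1 : ‖|x|‖ ≤ 1 := by rw [norm_abs_eq_norm]; simpa using hx
  have hTx : |T x| ≤ T |x| := by
    refine abs_le'.2 ⟨?_, ?_⟩
    · simpa using hT (|x| - x) (sub_nonneg.2 (le_abs_self x))
    · have := hT (|x| - -x) (sub_nonneg.2 (neg_le_abs x))
      rwa [map_sub, map_neg, sub_nonneg] at this
  calc |f n (T x)| ≤ (|f n| : StrongDual ℝ E) |T x| := abs_apply_le_abs _ _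
    _ ≤ (|f n| : StrongDual ℝ E) (T |x|) := dual_monotone (abs_nonneg (f n)) hTx
    _ ≤ ‖g n |x|‖ := le_abs_self _
    _ ≤ ‖g n‖ * 1 := (g n).le_opNorm_of_le hx1
    _ < ε := by rwa [mul_one]

end Dual

end BanachLattice

theorem mainTheorem8 (E : Type u) [NormedAddCommGroup E] [Lattice E] [HasSolidNorm E]
    [IsOrderedAddMonoid E] [NormedSpace ℝ E] [IsOrderedModule ℝ E] [CompleteSpace E]
    (hd : BanachLattice.PropertyD E) :
    BanachLattice.HasOrderContinuousNorm (StrongDual ℝ E) ↔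
      ∀ T : E →L[ℝ] E, BanachLattice.IsPositiveOperator T →
        BanachLattice.IsWeakAlmostLimited T → BanachLattice.IsAlmostLimited T :=
  ⟨fun hoc _ hT hTw => BanachLattice.isAlmostLimited_of_hasOrderContinuousNorm hd hoc hT hTw,
    BanachLattice.hasOrderContinuousNorm_of_forall_isAlmostLimited⟩
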